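/- Let $M$ be a finite-dimensional smooth manifold and let $\boldsymbol\eta\in\Omega^1(M,\mathbb{R}^k)$ be a $k$-contact form on $M$, i.e. a smooth $\mathbb{R}^k$-valued one-form such that $\ker\boldsymbol\eta\subset TM$ is non-zero (at every point) and of constant corank $k$, the distribution $\ker d\boldsymbol\eta=\{v\in TM : \iota_v d\boldsymbol\eta=0\}$ has constant rank $k$, and $\ker\boldsymbol\eta\cap\ker d\boldsymbol\eta=0$. Then the Reeb distribution $\ker d\boldsymbol\eta$ is regular (of locally constant rank), involutive and integrable. Here a distribution $D\subset TM$ is involutive if for any smooth vector fields $X,Y$ on an open set $U\subset M$ with values in $D$, the Lie bracket $[X,Y]$ has values in $D$ on $U$. It is integrable if every point of $M$ lies in the domain $U$ of a smooth chart $\varphi:U\to\mathbb{R}^n$, $n=\dim M$, for which there is a linear subspace $V\subset\mathbb{R}^n$ with $D_y=(d\varphi_y)^{-1}(V)$ for all $y\in U$; the slices of $U$ on which $\varphi$ is constant modulo $V$ are then integral manifolds of $D$. -/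

import Mathlib

open scoped Manifold ContDiff Topology

noncomputable section

namespace KContact

variable {E : Type*} [NormedAddCommGroup E] [NormedSpace ℝ E]
  {M : Type*} [TopologicalSpace M] [ChartedSpace E M]
  {F : Type*} [NormedAddCommGroup F] [NormedSpace ℝ F]

/-! Throughout, `M` is a manifold without boundary modelled on the normed space `E`, a one-form on
`M` with values in `F` is a field `η` of continuous linear maps `T_x M → F`, and a distribution
(a generalised subbundle of `TM`) is a field `D` of linear subspaces of the tangent spaces. -/

/-- Smoothness of an `F`-valued one-form, as a section of the bundle `Hom(TM, M × F)`. -/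
def IsSmoothOneForm [IsManifold 𝓘(ℝ, E) ∞ M]
    (η : (x : M) → TangentSpace 𝓘(ℝ, E) x →L[ℝ] F) : Prop :=
  ContMDiff 𝓘(ℝ, E) (𝓘(ℝ, E).prod 𝓘(ℝ, E →L[ℝ] F)) ∞
    (fun x ↦ Bundle.TotalSpace.mk' (E →L[ℝ] F)
      (E := fun x : M ↦ TangentSpace 𝓘(ℝ, E) x →L[ℝ] Bundle.Trivial M F x) x (η x))

/-- The coordinate expression of the one-form `η` in the preferred chart `φ` at `x₀`, that is,
the pullback of `η` by `φ⁻¹`, as a one-form on the model space. -/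
def oneFormInChart (η : (x : M) → TangentSpace 𝓘(ℝ, E) x →L[ℝ] F) (x₀ : M) (y : E) :
    E [⋀^Fin 1]→L[ℝ] F :=
  ContinuousAlternatingMap.ofSubsingleton ℝ E F (0 : Fin 1)
    ((η ((extChartAt 𝓘(ℝ, E) x₀).symm y)).comp
      (mfderiv 𝓘(ℝ, E) 𝓘(ℝ, E) (extChartAt 𝓘(ℝ, E) x₀).symm y))

/-- The exterior derivative of a one-form on a manifold: at `x`, it is the pullback by the
preferred chart at `x` of the exterior derivative of the coordinate expression of the form. -/
def extDerivOneForm (η : (x : M) → TangentSpace 𝓘(ℝ, E) x →L[ℝ] F) (x : M) :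
    TangentSpace 𝓘(ℝ, E) x [⋀^Fin 2]→L[ℝ] F :=
  (extDeriv (oneFormInChart η x) (extChartAt 𝓘(ℝ, E) x x)).compContinuousLinearMap
    (mfderiv 𝓘(ℝ, E) 𝓘(ℝ, E) (extChartAt 𝓘(ℝ, E) x) x)

/-- The distribution `ker η`. -/
def kerForm (η : (x : M) → TangentSpace 𝓘(ℝ, E) x →L[ℝ] F) (x : M) :
    Submodule ℝ (TangentSpace 𝓘(ℝ, E) x) :=
  (η x).ker

/-- The distribution `ker dη`, whose fibre at `x` is the kernel of `v ↦ ι_v (dη)_x`. It is the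
Reeb distribution when `η` is a `k`-contact form. -/
def reebDistribution (η : (x : M) → TangentSpace 𝓘(ℝ, E) x →L[ℝ] F) (x : M) :
    Submodule ℝ (TangentSpace 𝓘(ℝ, E) x) :=
  LinearMap.ker (extDerivOneForm η x).toAlternatingMap.curryLeft

/-- A `k`-contact form: a smooth `ℝ^k`-valued one-form `η` such that `ker η` is non-zero of
corank `k`, `ker dη` has rank `k`, and `ker η ∩ ker dη = 0`. -/
structure IsKContactForm [IsManifold 𝓘(ℝ, E) ∞ M] {k : ℕ}
    (η : (x : M) → TangentSpace 𝓘(ℝ, E) x →L[ℝ] (Fin k → ℝ)) : Prop where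
  smooth : IsSmoothOneForm η
  corank_ker : ∀ x, Module.finrank ℝ (TangentSpace 𝓘(ℝ, E) x ⧸ kerForm η x) = k
  ker_ne_bot : ∀ x, kerForm η x ≠ ⊥
  rank_reeb : ∀ x, Module.finrank ℝ (reebDistribution η x) = k
  ker_inf_reeb : ∀ x, kerForm η x ⊓ reebDistribution η x = ⊥

/-- A distribution is regular if its rank is locally constant. -/
def IsRegular (D : (x : M) → Submodule ℝ (TangentSpace 𝓘(ℝ, E) x)) : Prop :=
  IsLocallyConstant fun x ↦ Module.finrank ℝ (D x)

/-- A distribution is involutive if the Lie bracket of any two smooth vector fields with values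
in it, defined on any open set, has values in it. -/
def IsInvolutive [IsManifold 𝓘(ℝ, E) ∞ M]
    (D : (x : M) → Submodule ℝ (TangentSpace 𝓘(ℝ, E) x)) : Prop :=
  ∀ (U : Set M) (X Y : (x : M) → TangentSpace 𝓘(ℝ, E) x), IsOpen U →
    ContMDiffOn 𝓘(ℝ, E) 𝓘(ℝ, E).tangent ∞ (fun x ↦ (⟨x, X x⟩ : TangentBundle 𝓘(ℝ, E) M)) U →
    ContMDiffOn 𝓘(ℝ, E) 𝓘(ℝ, E).tangent ∞ (fun x ↦ (⟨x, Y x⟩ : TangentBundle 𝓘(ℝ, E) M)) U →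
    (∀ x ∈ U, X x ∈ D x) → (∀ x ∈ U, Y x ∈ D x) →
    ∀ x ∈ U, VectorField.mlieBracket 𝓘(ℝ, E) X Y x ∈ D x

/-- A distribution is integrable if it is locally the tangent distribution of a foliation: every
point lies in the domain of a smooth chart `φ` of `M` which maps `D` to the constant distribution
given by a linear subspace `V` of the model space. The slices `φ = c mod V` of such a chart are
then integral manifolds of `D`. -/
def IsIntegrable [IsManifold 𝓘(ℝ, E) ∞ M]
    (D : (x : M) → Submodule ℝ (TangentSpace 𝓘(ℝ, E) x)) : Prop :=
  ∀ x : M, ∃ φ ∈ IsManifold.maximalAtlas 𝓘(ℝ, E) ∞ M, x ∈ φ.source ∧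
    ∃ V : Submodule ℝ E, ∀ y ∈ φ.source, ∀ v : TangentSpace 𝓘(ℝ, E) y,
      v ∈ D y ↔ (mfderiv 𝓘(ℝ, E) 𝓘(ℝ, E) φ y v : E) ∈ V

end KContact

end

open scoped Manifold ContDiff Topology

noncomputable section

namespace KContact

section Nemytskii

universe u

variable {K : Type*} [TopologicalSpace K] [CompactSpace K]

/-- Pointwise evaluation of a continuous family of continuous linear maps on a continuous family of
vectors, as a continuous bilinear map. -/
def pointwiseApply (K : Type*) [TopologicalSpace K] [CompactSpace K]
    (X Y : Type*) [NormedAddCommGroup X] [NormedSpace ℝ X]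
    [NormedAddCommGroup Y] [NormedSpace ℝ Y] : C(K, X →L[ℝ] Y) →L[ℝ] C(K, X) →L[ℝ] C(K, Y) :=
  LinearMap.mkContinuous₂
    (LinearMap.mk₂ ℝ (fun (L : C(K, X →L[ℝ] Y)) (h : C(K, X)) ↦
        (⟨fun t ↦ L t (h t), by fun_prop⟩ : C(K, Y)))
      (fun _ _ _ ↦ by ext; simp) (fun _ _ _ ↦ by ext; simp)
      (fun _ _ _ ↦ by ext; simp) (fun _ _ _ ↦ by ext; simp)) 1
    (fun L h ↦ by
      rw [one_mul, ContinuousMap.norm_le _ (by positivity)]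
      intro t
      exact (L t).le_of_opNorm_le_of_le (L.norm_coe_le_norm t) (h.norm_coe_le_norm t))

@[simp] theorem pointwiseApply_apply {X Y : Type*} [NormedAddCommGroup X] [NormedSpace ℝ X]
    [NormedAddCommGroup Y] [NormedSpace ℝ Y] (L : C(K, X →L[ℝ] Y)) (h : C(K, X)) (t : K) :
    pointwiseApply K X Y L h t = L t (h t) := rfl

theorem hasFDerivAt_continuousMap_comp {X Y : Type*} [NormedAddCommGroup X] [NormedSpace ℝ X]
    [NormedAddCommGroup Y] [NormedSpace ℝ Y] (g : C(X, Y)) (g' : C(X, X →L[ℝ] Y))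
    (hg : ∀ x, HasFDerivAt g (g' x) x) (u : C(K, X)) :
    HasFDerivAt (fun u : C(K, X) ↦ g.comp u) (pointwiseApply K X Y (g'.comp u)) u := by
  rw [hasFDerivAt_iff_isLittleO, Asymptotics.isLittleO_iff]
  intro c hc
  have hu := (isCompact_range u.continuous).uniformContinuousAt_of_continuousAt g'
    (fun a _ ↦ g'.continuous.continuousAt) (Metric.dist_mem_uniformity hc)
  obtain ⟨δ, hδ, H⟩ := Metric.mem_uniformity_dist.1 hu
  filter_upwards [Metric.ball_mem_nhds u hδ] with v hv
  rw [ContinuousMap.norm_le _ (by positivity)]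
  intro t
  have hvt : v t ∈ Metric.ball (u t) δ :=
    (ContinuousMap.dist_apply_le_dist t).trans_lt hv
  have := (convex_ball (u t) δ).norm_image_sub_le_of_norm_hasFDerivWithin_le'
    (f := g) (f' := g') (φ := g' (u t)) (C := c)
    (fun z _ ↦ (hg z).hasFDerivWithinAt)
    (fun z hz ↦ by
      have h2 : dist (g' (u t)) (g' z) < c :=
        H (a := u t) (b := z) (by rw [dist_comm]; exact hz) (Set.mem_range_self t)
      rw [← dist_eq_norm, dist_comm]; exact h2.le)
    (Metric.mem_ball_self hδ) hvt
  refine le_trans this ?_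
  gcongr
  exact (v - u).norm_coe_le_norm t

theorem contDiff_nat_continuousMap_comp {X : Type u} [NormedAddCommGroup X] [NormedSpace ℝ X]
    (n : ℕ) : ∀ {Y : Type u} [NormedAddCommGroup Y] [NormedSpace ℝ Y] (g : C(X, Y)),
      ContDiff ℝ n g → ContDiff ℝ n (fun u : C(K, X) ↦ g.comp u) := by
  induction n with
  | zero =>
    intro Y _ _ g _
    exact contDiff_zero.2 (ContinuousMap.continuous_postcomp g)
  | succ n ih =>
    intro Y _ _ g hg
    push_cast at hg ⊢
    obtain ⟨g', hg', hd⟩ := contDiff_succ_iff_hasFDerivAt.1 hg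
    refine contDiff_succ_iff_hasFDerivAt.2
      ⟨fun u ↦ pointwiseApply K X Y ((⟨g', hg'.continuous⟩ : C(X, X →L[ℝ] Y)).comp u), ?_,
        fun u ↦ hasFDerivAt_continuousMap_comp g ⟨g', hg'.continuous⟩ hd u⟩
    exact (pointwiseApply K X Y).contDiff.comp (ih ⟨g', hg'.continuous⟩ hg')

/-- The composition operator `u ↦ g ∘ u` on continuous maps is smooth when `g` is. -/
theorem contDiff_continuousMap_comp {X : Type u} [NormedAddCommGroup X] [NormedSpace ℝ X]
    {Y : Type u} [NormedAddCommGroup Y] [NormedSpace ℝ Y] (g : C(X, Y))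
    (hg : ContDiff ℝ ∞ g) : ContDiff ℝ ∞ (fun u : C(K, X) ↦ g.comp u) :=
  contDiff_infty.2 fun n ↦ contDiff_nat_continuousMap_comp n g (contDiff_infty.1 hg n)

end Nemytskii

section Inverse

/-- Inverse function theorem for smooth maps, with smoothness and invertibility of the derivative
on the whole domain. -/
theorem exists_openPartialHomeomorph_of_contDiffOn
    {X Y : Type*} [NormedAddCommGroup X] [NormedSpace ℝ X] [CompleteSpace X]
    [NormedAddCommGroup Y] [NormedSpace ℝ Y] {f : X → Y} {s : Set X} (hs : IsOpen s)
    (hf : ContDiffOn ℝ ∞ f s) {x : X} (hx : x ∈ s) (f' : X ≃L[ℝ] Y)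
    (hf' : HasFDerivAt f (f' : X →L[ℝ] Y) x) :
    ∃ e : OpenPartialHomeomorph X Y, x ∈ e.source ∧ e.source ⊆ s ∧ ⇑e = f ∧
      ContDiffOn ℝ ∞ e.symm e.target ∧
      ∀ y ∈ e.source, ∃ L : X ≃L[ℝ] Y, HasFDerivAt f (L : X →L[ℝ] Y) y := by
  have hfx : ContDiffAt ℝ ∞ f x := hf.contDiffAt (hs.mem_nhds hx)
  set e₀ := hfx.toOpenPartialHomeomorph f hf' (by simp)
  have hcont : ContinuousOn (fderiv ℝ f) s := hf.continuousOn_fderiv_of_isOpen hs (by simp)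
  set t : Set X := s ∩ fderiv ℝ f ⁻¹' Set.range ((↑) : (X ≃L[ℝ] Y) → X →L[ℝ] Y)
  have ht : IsOpen t := hcont.isOpen_inter_preimage hs ContinuousLinearEquiv.isOpen
  have hxt : x ∈ t := ⟨hx, f', hf'.fderiv.symm⟩
  have hsource : (e₀.restr t).source = e₀.source ∩ t := e₀.restr_source' t ht
  have hder : ∀ y ∈ (e₀.restr t).source, ∃ L : X ≃L[ℝ] Y, HasFDerivAt f (L : X →L[ℝ] Y) y := by
    intro y hy
    rw [hsource] at hy
    obtain ⟨L, hL⟩ := hy.2.2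
    refine ⟨L, ?_⟩
    rw [hL]
    exact ((hf.contDiffAt (hs.mem_nhds hy.2.1)).differentiableAt (by simp)).hasFDerivAt
  refine ⟨e₀.restr t, ?_, ?_, rfl, ?_, hder⟩
  · rw [hsource]
    exact ⟨hfx.mem_toOpenPartialHomeomorph_source hf' (by simp), hxt⟩
  · rw [hsource]
    exact fun y hy ↦ hy.2.1
  · intro z hz
    have hz' := (e₀.restr t).map_target hz
    obtain ⟨L, hL⟩ := hder _ hz'
    rw [hsource] at hz'
    exact ((e₀.restr t).contDiffAt_symm hz hL
      (hf.contDiffAt (hs.mem_nhds hz'.2.1))).contDiffWithinAt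

end Inverse

section Flow

open unitInterval

/-- The primitive vanishing at `0`, as a continuous linear operator on `C([0, 1], E)`. -/
def primitiveCLM (E : Type*) [NormedAddCommGroup E] [NormedSpace ℝ E] [CompleteSpace E] :
    C(I, E) →L[ℝ] C(I, E) :=
  LinearMap.mkContinuous
    { toFun := fun u ↦ ⟨fun t ↦ ∫ s in (0 : ℝ)..t, u (Set.projIcc 0 1 zero_le_one s),
        (intervalIntegral.continuous_primitive (fun _ _ ↦
          (u.continuous.comp continuous_projIcc).intervalIntegrable _ _) 0).comp
            continuous_subtype_val⟩
      map_add' := fun u v ↦ by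
        ext t
        exact intervalIntegral.integral_add
          ((u.continuous.comp continuous_projIcc).intervalIntegrable _ _)
          ((v.continuous.comp continuous_projIcc).intervalIntegrable _ _)
      map_smul' := fun c u ↦ by
        ext t
        exact intervalIntegral.integral_smul c _ } 1
    (fun u ↦ by
      rw [one_mul, ContinuousMap.norm_le _ (by positivity)]
      intro t
      have := intervalIntegral.norm_integral_le_of_norm_le_const (a := (0 : ℝ)) (b := t)
        (f := fun s ↦ u (Set.projIcc 0 1 zero_le_one s)) (C := ‖u‖)
        (fun s _ ↦ u.norm_coe_le_norm _)
      refine this.trans ?_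
      rw [sub_zero, abs_of_nonneg t.2.1]
      exact mul_le_of_le_one_right (by positivity) t.2.2)

theorem primitiveCLM_apply {E : Type*} [NormedAddCommGroup E] [NormedSpace ℝ E] [CompleteSpace E]
    (u : C(I, E)) (t : I) :
    primitiveCLM E u t = ∫ s in (0 : ℝ)..t, u (Set.projIcc 0 1 zero_le_one s) := rfl

theorem hasDerivAt_primitive {E : Type*} [NormedAddCommGroup E] [NormedSpace ℝ E]
    [CompleteSpace E] (u : C(I, E)) (t : ℝ) :
    HasDerivAt (fun t : ℝ ↦ ∫ s in (0 : ℝ)..t, u (Set.projIcc 0 1 zero_le_one s))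
      (u (Set.projIcc 0 1 zero_le_one t)) t :=
  ((u.continuous.comp continuous_projIcc).integral_hasStrictDerivAt 0 t).hasDerivAt

theorem primitiveCLM_eq_of_hasDerivAt {E : Type*} [NormedAddCommGroup E] [NormedSpace ℝ E]
    [CompleteSpace E] {f : ℝ → E} {u v : C(I, E)} (hf : ∀ t : I, HasDerivAt f (u t) t)
    (hv : ∀ t : I, f t = v t) (h0 : f 0 = 0) : primitiveCLM E u = v := by
  ext t
  rw [primitiveCLM_apply, ← hv t]
  have := intervalIntegral.integral_eq_sub_of_hasDerivAt (a := (0 : ℝ)) (b := t) (f := f)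
    (f' := fun s ↦ u (Set.projIcc 0 1 zero_le_one s)) (fun s hs ↦ by
      rw [Set.uIcc_of_le t.2.1] at hs
      have hs' : s ∈ Set.Icc (0 : ℝ) 1 := ⟨hs.1, hs.2.trans t.2.2⟩
      simpa [Set.projIcc_of_mem zero_le_one hs'] using hf ⟨s, hs'⟩)
    ((u.continuous.comp continuous_projIcc).intervalIntegrable _ _)
  rw [this, h0, sub_zero]

universe u

variable {E : Type u} [NormedAddCommGroup E] [NormedSpace ℝ E]
  {G : Type} [NormedAddCommGroup G] [NormedSpace ℝ G]

/-- The map sending a vector `c` and a curve `u` to the curve `t ↦ (u t, c)`. -/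
def curveWithParameter (G : Type*) [NormedAddCommGroup G] [NormedSpace ℝ G] (E : Type*)
    [NormedAddCommGroup E] [NormedSpace ℝ E] : G × C(I, E) →L[ℝ] C(I, E × G) :=
  LinearMap.mkContinuous
    { toFun := fun p ↦ ⟨fun t ↦ (p.2 t, p.1), by fun_prop⟩
      map_add' := fun p q ↦ rfl
      map_smul' := fun c p ↦ rfl } 1
    (fun p ↦ by
      rw [one_mul, ContinuousMap.norm_le _ (by positivity)]
      intro t
      exact max_le ((p.2.norm_coe_le_norm t).trans (le_max_right _ _)) (le_max_left _ _))

@[simp] theorem curveWithParameter_apply (p : G × C(I, E)) (t : I) :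
    curveWithParameter G E p t = (p.2 t, p.1) := rfl

variable [CompleteSpace E]

/-- The map `(c, u) ↦ (c, u - ∫ f(u, c))`: a curve `u` with image `(c, y)`, where `y` is constant,
is an integral curve of the vector field `f(·, c)` starting from `y`. -/
def flowEquation (f : C(E × G, E)) (p : G × C(I, E)) : G × C(I, E) :=
  (p.1, p.2 - primitiveCLM E (f.comp (curveWithParameter G E p)))

/-- The derivative of `flowEquation`. -/
def flowEquationDeriv (f' : C(E × G, E × G →L[ℝ] E)) (p : G × C(I, E)) :
    G × C(I, E) →L[ℝ] G × C(I, E) :=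
  (ContinuousLinearMap.fst ℝ G C(I, E)).prod (ContinuousLinearMap.snd ℝ G C(I, E) -
    (primitiveCLM E).comp ((pointwiseApply I (E × G) E (f'.comp (curveWithParameter G E p))).comp
      (curveWithParameter G E)))

theorem hasFDerivAt_flowEquation (f : C(E × G, E)) (f' : C(E × G, E × G →L[ℝ] E))
    (hf : ∀ x, HasFDerivAt f (f' x) x) (p : G × C(I, E)) :
    HasFDerivAt (flowEquation f) (flowEquationDeriv f' p) p := by
  have h1 := HasFDerivAt.comp (g := fun u : C(I, E × G) ↦ f.comp u) p
    (hasFDerivAt_continuousMap_comp f f' hf _) (curveWithParameter G E).hasFDerivAt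
  have h2 := HasFDerivAt.comp p (primitiveCLM E).hasFDerivAt h1
  exact hasFDerivAt_fst.prodMk (hasFDerivAt_snd.sub h2)

theorem contDiff_flowEquation (f : C(E × G, E)) (hf : ContDiff ℝ ∞ f) :
    ContDiff ℝ ∞ (flowEquation f) :=
  contDiff_fst.prodMk (contDiff_snd.sub ((primitiveCLM E).contDiff.comp
    ((contDiff_continuousMap_comp f hf).comp (curveWithParameter G E).contDiff)))

/-- The derivative of `flowEquation` is invertible where the vector field is identically zero. -/
theorem exists_equiv_flowEquationDeriv (f' : C(E × G, E × G →L[ℝ] E)) (c : G) (u : C(I, E))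
    (hf' : ∀ y v, f' (y, c) (v, 0) = 0) : ∃ L : (G × C(I, E)) ≃L[ℝ] (G × C(I, E)),
      (L : G × C(I, E) →L[ℝ] G × C(I, E)) = flowEquationDeriv f' (c, u) := by
  set S : G × C(I, E) →L[ℝ] C(I, E) :=
    (primitiveCLM E).comp
      ((pointwiseApply I (E × G) E (f'.comp (curveWithParameter G E (c, u)))).comp
      (curveWithParameter G E)) with hS
  have hS0 : ∀ v w, S (v, w) = S (v, 0) := by
    intro v w
    simp only [hS, ContinuousLinearMap.comp_apply]
    congr 1
    ext t
    have h1 : ((w t, v) : E × G) = (w t, 0) + (0, v) := by simp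
    simp only [pointwiseApply_apply, curveWithParameter_apply, ContinuousMap.comp_apply,
      ContinuousMap.zero_apply]
    rw [h1, map_add, hf', zero_add]
  refine ⟨ContinuousLinearEquiv.equivOfInverse
    ((ContinuousLinearMap.fst ℝ G C(I, E)).prod (ContinuousLinearMap.snd ℝ G C(I, E) - S))
    ((ContinuousLinearMap.fst ℝ G C(I, E)).prod (ContinuousLinearMap.snd ℝ G C(I, E) + S))
    ?_ ?_, rfl⟩
  · rintro ⟨v, w⟩
    simp [hS0 v (w - _), hS0 v w]
  · rintro ⟨v, w⟩
    simp [hS0 v (w + _), hS0 v w]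

/-- If the vector fields `A e`, `A c` commute, then `t ↦ t • A e` solves the equation of
variations along the integral curves of `A c`. -/
theorem flowEquationDeriv_apply_of_commute (f : C(E × G, E)) (f' : C(E × G, E × G →L[ℝ] E))
    (A : E → G →L[ℝ] E) (A' : E → E →L[ℝ] G →L[ℝ] E) (hA : ∀ x, HasFDerivAt A (A' x) x)
    (hf : ∀ y c, f (y, c) = A y c) (hf' : ∀ y c v e, f' (y, c) (v, e) = A y e + A' y v c)
    {s : Set E} (hcomm : ∀ y ∈ s, ∀ e c, A' y (A y e) c = A' y (A y c) e)
    {c : G} {u : C(I, E)} {y : E} (hu : ∀ t, u t ∈ s)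
    (hc : flowEquation f (c, u) = (c, ContinuousLinearMap.const ℝ I y)) (e : G) (w : C(I, E))
    (hw : ∀ t : I, w t = (t : ℝ) • A (u t) e) :
    flowEquationDeriv f' (c, u) (e, w) = (e, 0) := by
  set h : C(I, E) := f.comp (curveWithParameter G E (c, u))
  set U : ℝ → E := fun t ↦ y + ∫ s in (0 : ℝ)..t, h (Set.projIcc 0 1 zero_le_one s)
  have hU : ∀ t : ℝ, HasDerivAt U (h (Set.projIcc 0 1 zero_le_one t)) t := fun t ↦
    (hasDerivAt_primitive h t).const_add y
  have hUu : ∀ t : I, U t = u t := by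
    intro t
    have h1 : u - primitiveCLM E h = ContinuousLinearMap.const ℝ I y := congrArg Prod.snd hc
    have h2 := congrArg (fun v : C(I, E) ↦ v t) h1
    have h3 : u t - primitiveCLM E h t = y := h2
    rw [primitiveCLM_apply] at h3
    simp only [U]
    rw [← h3]
    abel
  have hU' : ∀ t : I, HasDerivAt U (A (u t) c) t := by
    intro t
    have := hU t
    rw [Set.projIcc_val] at this
    exact (hf (u t) c) ▸ this
  have hW : ∀ t : I, HasDerivAt (fun t : ℝ ↦ t • A (U t) e)
      (A (u t) e + A' (u t) (w t) c) t := by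
    intro t
    have hAU : HasDerivAt (fun t : ℝ ↦ A (U t) e) (A' (u t) (A (u t) c) e) t := by
      have h1 : HasDerivAt (fun t : ℝ ↦ A (U t)) (A' (U t) (A (u t) c)) t :=
        (hA (U t)).comp_hasDerivAt (t : ℝ) (hU' t)
      rw [hUu] at h1
      simpa using h1.clm_apply (hasDerivAt_const (t : ℝ) e)
    have := (hasDerivAt_id (t : ℝ)).smul hAU
    convert this using 1
    · rfl
    simp only [id, one_smul, hUu, hw, map_smul, smul_apply]
    rw [hcomm _ (hu t), add_comm]
  have key := primitiveCLM_eq_of_hasDerivAt (f := fun t : ℝ ↦ t • A (U t) e)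
    (u := pointwiseApply I (E × G) E (f'.comp (curveWithParameter G E (c, u)))
      (curveWithParameter G E (e, w))) (v := w)
    (fun t ↦ by simpa [hf'] using hW t) (fun t ↦ by simp [hUu, hw]) (by simp)
  refine Prod.ext rfl ?_
  change w - primitiveCLM E _ = 0
  rw [sub_eq_zero]
  exact key.symm

/-- The map `(c, y) ↦ exp(c)(y)` given by the flows of a family of commuting vector fields `A c`,
linear in `c`. -/
theorem exists_flow_of_commute (A : E → G →L[ℝ] E) [CompleteSpace G] (hA : ContDiff ℝ ∞ A)
    {s : Set E} (hs : IsOpen s)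
    (hcomm : ∀ y ∈ s, ∀ e c, fderiv ℝ A y (A y e) c = fderiv ℝ A y (A y c) e)
    {y₀ : E} (hy₀ : y₀ ∈ s) :
    ∃ (Φ : G × E → E) (N : Set (G × E)), IsOpen N ∧ (0, y₀) ∈ N ∧ ContDiffOn ℝ ∞ Φ N ∧
      (∀ y, (0, y) ∈ N → Φ (0, y) = y) ∧
      ∀ p ∈ N, Φ p ∈ s ∧ ∀ e, fderiv ℝ Φ p (e, 0) = A (Φ p) e := by
  have hfs : ContDiff ℝ ∞ (fun p : E × G ↦ A p.1 p.2) :=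
    (hA.comp contDiff_fst).clm_apply contDiff_snd
  set f : C(E × G, E) := ⟨fun p ↦ A p.1 p.2, hfs.continuous⟩
  set f' : C(E × G, E × G →L[ℝ] E) := ⟨fderiv ℝ f, hfs.continuous_fderiv (by simp)⟩
  have hd : ∀ x, HasFDerivAt f (f' x) x := fun x ↦ (hfs.differentiable (by simp) x).hasFDerivAt
  have hAd : ∀ x, HasFDerivAt A (fderiv ℝ A x) x := fun x ↦
    (hA.differentiable (by simp) x).hasFDerivAt
  have hf' : ∀ y c v e, f' (y, c) (v, e) = A y e + fderiv ℝ A y v c := by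
    intro y c v e
    have h1 : HasFDerivAt (fun p : E × G ↦ A p.1 p.2) _ (y, c) :=
      ((hAd y).comp (y, c) hasFDerivAt_fst).clm_apply hasFDerivAt_snd
    rw [(hd (y, c)).unique h1]
    simp
  set u₀ : C(I, E) := ContinuousLinearMap.const ℝ I y₀
  obtain ⟨L₀, hL₀⟩ := exists_equiv_flowEquationDeriv f' 0 u₀ (fun y v ↦ by simp [hf'])
  obtain ⟨e, hxe, -, hef, hsymm, hder⟩ := exists_openPartialHomeomorph_of_contDiffOn isOpen_univ
    (contDiff_flowEquation f hfs).contDiffOn (Set.mem_univ (0, u₀)) L₀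
    (by rw [hL₀]; exact hasFDerivAt_flowEquation f f' hd _)
  have hzero : ∀ u : C(I, E), flowEquation f (0, u) = (0, u) := fun u ↦ by
    have : f.comp (curveWithParameter G E (0, u)) = 0 := by ext t; simp [f]
    simp [flowEquation, this]
  set ι : G × E →L[ℝ] G × C(I, E) :=
    (ContinuousLinearMap.id ℝ G).prodMap (ContinuousLinearMap.const ℝ I)
  have hι0 : ι (0, y₀) = (0, u₀) := rfl
  set T : Set (G × C(I, E)) := {p | Set.MapsTo p.2 Set.univ s}
  have hT : IsOpen T := (ContinuousMap.isOpen_setOfPred_mapsTo isCompact_univ hs).preimage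
    continuous_snd
  have hN' : IsOpen (e.target ∩ e.symm ⁻¹' T) := e.symm.isOpen_inter_preimage hT
  have heq : ∀ p, ι p ∈ e.target → flowEquation f (e.symm (ι p)) = ι p := fun p hp ↦ by
    rw [← hef]; exact e.right_inv hp
  have hfst : ∀ p, ι p ∈ e.target → (e.symm (ι p)).1 = p.1 := fun p hp ↦
    congrArg Prod.fst (heq p hp)
  have hΦ0 : ∀ y, ι (0, y) ∈ e.target →
      (e.symm (ι (0, y))).2 = ContinuousLinearMap.const ℝ I y := by
    intro y hp
    have h1 := heq _ hp
    have h2 : e.symm (ι (0, y)) = (0, (e.symm (ι (0, y))).2) := Prod.ext (hfst _ hp) rfl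
    rw [h2, hzero] at h1
    exact congrArg Prod.snd h1
  refine ⟨fun p ↦ (e.symm (ι p)).2 1, ι ⁻¹' (e.target ∩ e.symm ⁻¹' T), hN'.preimage ι.continuous,
    ?_, ?_, ?_, ?_⟩
  · have h1 : (0, u₀) ∈ e.target := by
      have := e.map_source hxe
      rwa [hef, hzero] at this
    refine ⟨h1, ?_⟩
    change Set.MapsTo (e.symm (ι (0, y₀))).2 Set.univ s
    rw [hΦ0 y₀ h1]
    exact fun _ _ ↦ hy₀
  · exact ((ContinuousMap.evalCLM ℝ (1 : I)).comp
      (ContinuousLinearMap.snd ℝ G C(I, E))).contDiff.comp_contDiffOn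
        (hsymm.comp ι.contDiff.contDiffOn fun p hp ↦ hp.1)
  · intro y hy
    simp only [hΦ0 y hy.1]
    rfl
  · rintro ⟨c, y⟩ hp
    refine ⟨hp.2 (Set.mem_univ _), fun v ↦ ?_⟩
    set u : C(I, E) := (e.symm (ι (c, y))).2 with hu
    have hcu : e.symm (ι (c, y)) = (c, u) := Prod.ext (hfst _ hp.1) rfl
    set w : C(I, E) := ⟨fun t ↦ (t : ℝ) • A (u t) v, by
      have := hA.continuous.comp u.continuous
      exact continuous_subtype_val.smul (this.clm_apply continuous_const)⟩ with hw
    obtain ⟨L, hL⟩ := hder (e.symm (ι (c, y))) (e.map_target hp.1)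
    have hLe : (L : G × C(I, E) →L[ℝ] G × C(I, E)) = flowEquationDeriv f' (c, u) := by
      rw [hcu] at hL
      exact hL.unique (hasFDerivAt_flowEquation f f' hd _)
    have hLw : L (v, w) = (v, 0) := by
      change (L : G × C(I, E) →L[ℝ] G × C(I, E)) (v, w) = _
      rw [hLe]
      refine flowEquationDeriv_apply_of_commute f f' A (fderiv ℝ A) hAd (fun _ _ ↦ rfl) hf'
        hcomm
        (fun t ↦ hp.2 (Set.mem_univ t)) ?_ v w (fun t ↦ rfl) (y := y)
      rw [← hcu, heq _ hp.1]
      rfl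
    have hQ : HasFDerivAt e.symm (L.symm : G × C(I, E) →L[ℝ] G × C(I, E)) (ι (c, y)) :=
      e.hasFDerivAt_symm hp.1 (by rw [hef]; exact hL)
    have hΦ : HasFDerivAt (fun p ↦ (e.symm (ι p)).2 1)
        (((ContinuousMap.evalCLM ℝ (1 : I)).comp (ContinuousLinearMap.snd ℝ G C(I, E))).comp
          ((L.symm : G × C(I, E) →L[ℝ] G × C(I, E)).comp ι)) (c, y) :=
      ((ContinuousMap.evalCLM ℝ (1 : I)).comp
        (ContinuousLinearMap.snd ℝ G C(I, E))).hasFDerivAt.comp (c, y)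
          (hQ.comp (c, y) ι.hasFDerivAt)
    rw [hΦ.fderiv]
    have hι : ι (v, 0) = (v, 0) := by simp [ι]
    have h3 : L.symm (v, 0) = (v, w) := by rw [← hLw]; simp
    simp only [ContinuousLinearMap.comp_apply, hι, ContinuousLinearEquiv.coe_coe, h3]
    change w 1 = _
    simp [hw, hu]

/-- Frobenius theorem for a distribution spanned by commuting vector fields: there are local
coordinates in which it is constant. -/
theorem exists_straightening_of_commute [FiniteDimensional ℝ E] [FiniteDimensional ℝ G]
    (A : E → G →L[ℝ] E) (hA : ContDiff ℝ ∞ A) {s : Set E} (hs : IsOpen s)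
    (hcomm : ∀ y ∈ s, ∀ e c, fderiv ℝ A y (A y e) c = fderiv ℝ A y (A y c) e)
    {y₀ : E} (hy₀ : y₀ ∈ s) (hinj : Function.Injective (A y₀)) :
    ∃ ψ : OpenPartialHomeomorph E E, y₀ ∈ ψ.source ∧ ψ.source ⊆ s ∧
      ContDiffOn ℝ ∞ ψ ψ.source ∧ ContDiffOn ℝ ∞ ψ.symm ψ.target ∧
      ∃ V : Submodule ℝ E, ∀ y ∈ ψ.source, ∀ v, v ∈ (A y).range ↔ fderiv ℝ ψ y v ∈ V := by
  have : CompleteSpace G := FiniteDimensional.complete ℝ G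
  obtain ⟨Φ, N, hN, h0N, hΦ, hΦ0, hΦd⟩ := exists_flow_of_commute A hA hs hcomm hy₀
  obtain ⟨p₀, hp₀⟩ := (A y₀ : G →ₗ[ℝ] E).exists_leftInverse_of_injective
    (LinearMap.ker_eq_bot.2 hinj)
  set p : E →L[ℝ] G := LinearMap.toContinuousLinearMap p₀
  have hp : ∀ c, p (A y₀ c) = c := fun c ↦ LinearMap.congr_fun hp₀ c
  set q : E →L[ℝ] E := ContinuousLinearMap.id ℝ E - (A y₀).comp p
  have hq : ∀ c, q (A y₀ c) = 0 := fun c ↦ by simp [q, hp]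
  set j : E → G × E := fun z ↦ (p z, y₀ + q z)
  have hj : ∀ z, HasFDerivAt j (p.prod q) z := fun z ↦
    p.hasFDerivAt.prodMk (q.hasFDerivAt.const_add y₀)
  have hjs : ContDiff ℝ ∞ j := p.contDiff.prodMk (contDiff_const.add q.contDiff)
  have hj0 : j 0 = (0, y₀) := by simp [j]
  have hjN : IsOpen (j ⁻¹' N) := hN.preimage hjs.continuous
  have h0 : (0 : E) ∈ j ⁻¹' N := by simpa [hj0] using h0N
  have hΨ : ContDiffOn ℝ ∞ (Φ ∘ j) (j ⁻¹' N) := hΦ.comp hjs.contDiffOn fun z hz ↦ hz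
  have hΦdiff : ∀ x ∈ N, HasFDerivAt Φ (fderiv ℝ Φ x) x := fun x hx ↦
    ((hΦ.contDiffAt (hN.mem_nhds hx)).differentiableAt (by simp)).hasFDerivAt
  have hΨd : ∀ z ∈ j ⁻¹' N, HasFDerivAt (Φ ∘ j) ((fderiv ℝ Φ (j z)).comp (p.prod q)) z :=
    fun z hz ↦ (hΦdiff _ hz).comp z (hj z)
  have hΦy : ∀ v, fderiv ℝ Φ (0, y₀) (0, v) = v := by
    intro v
    have h1 : HasFDerivAt (fun y : E ↦ Φ (0, y))
        ((fderiv ℝ Φ (0, y₀)).comp (ContinuousLinearMap.inr ℝ G E)) y₀ :=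
      (hΦdiff _ h0N).comp y₀ (hasFDerivAt_prodMk_right 0 y₀)
    have h2 : (fun y : E ↦ Φ (0, y)) =ᶠ[𝓝 y₀] id := by
      have : (fun y : E ↦ ((0 : G), y)) ⁻¹' N ∈ 𝓝 y₀ :=
        (hN.preimage (by fun_prop)).mem_nhds h0N
      filter_upwards [this] with y hy using hΦ0 y hy
    have h3 := h1.unique ((hasFDerivAt_id y₀).congr_of_eventuallyEq h2)
    simpa using congrArg (fun T : E →L[ℝ] E ↦ T v) h3
  have hid : HasFDerivAt (Φ ∘ j) ((ContinuousLinearEquiv.refl ℝ E : E ≃L[ℝ] E) : E →L[ℝ] E) 0 := by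
    convert hΨd 0 h0 using 1
    ext v
    have h1 : ((p v, q v) : G × E) = (p v, 0) + (0, q v) := by simp
    simp only [ContinuousLinearMap.comp_apply, ContinuousLinearMap.prod_apply, hj0]
    rw [h1, map_add, hΦy, (hΦd _ h0N).2, hΦ0 _ h0N]
    simp [q]
  obtain ⟨e, h0e, hes, hef, hsymm, hder⟩ := exists_openPartialHomeomorph_of_contDiffOn hjN hΨ h0
    (ContinuousLinearEquiv.refl ℝ E) hid
  refine ⟨e.symm, ?_, ?_, hsymm, ?_, (A y₀).range, ?_⟩
  · have := e.map_source h0e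
    rw [hef] at this
    simpa [hj0, hΦ0 _ h0N] using this
  · intro y hy
    have h1 := (hΦd _ (hes (e.map_target hy))).1
    have h2 : Φ (j (e.symm y)) = y := by
      have := e.right_inv hy
      rwa [hef] at this
    rwa [h2] at h1
  · rw [e.symm_symm, hef]
    exact hΨ.mono hes
  · intro y hy v
    have hz : e.symm y ∈ e.source := e.map_target hy
    obtain ⟨L, hL⟩ := hder _ hz
    have h2 : Φ (j (e.symm y)) = y := by
      have := e.right_inv hy
      rwa [hef] at this
    have hLA : ∀ c, L (A y₀ c) = A y c := by
      intro c
      have h3 : (L : E →L[ℝ] E) = _ := hL.unique (hΨd _ (hes hz))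
      change (L : E →L[ℝ] E) (A y₀ c) = _
      rw [h3]
      simp only [ContinuousLinearMap.comp_apply, ContinuousLinearMap.prod_apply, hp, hq]
      rw [(hΦd _ (hes hz)).2, h2]
    have hd : HasFDerivAt e.symm (L.symm : E →L[ℝ] E) y :=
      e.hasFDerivAt_symm hy (by rw [hef]; exact hL)
    rw [hd.fderiv]
    simp only [LinearMap.mem_range, ContinuousLinearMap.coe_coe, ContinuousLinearEquiv.coe_coe]
    refine exists_congr fun c ↦ ?_
    rw [← hLA c, L.eq_symm_apply]

end Flow

section Local

variable {E : Type*} [NormedAddCommGroup E] [NormedSpace ℝ E]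
  {F : Type*} [NormedAddCommGroup F] [NormedSpace ℝ F]

/-- The exterior derivative of a one-form on a normed space, as a bilinear map. -/
def extDerivBilin (α : E → E →L[ℝ] F) (x : E) : E →L[ℝ] E →L[ℝ] F :=
  fderiv ℝ α x - (fderiv ℝ α x).flip

theorem extDerivBilin_apply (α : E → E →L[ℝ] F) (x v w : E) :
    extDerivBilin α x v w = fderiv ℝ α x v w - fderiv ℝ α x w v := rfl

theorem extDerivBilin_swap (α : E → E →L[ℝ] F) (x v w : E) :
    extDerivBilin α x v w = -extDerivBilin α x w v := by
  simp [extDerivBilin_apply]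

theorem extDeriv_ofSubsingleton_apply {α : E → E →L[ℝ] F} {x : E} (hα : DifferentiableAt ℝ α x)
    (v : Fin 2 → E) :
    extDeriv (fun y ↦ ContinuousAlternatingMap.ofSubsingleton ℝ E F (0 : Fin 1) (α y)) x v =
      extDerivBilin α x (v 0) (v 1) := by
  have hd : DifferentiableAt ℝ
      (fun y ↦ ContinuousAlternatingMap.ofSubsingleton ℝ E F (0 : Fin 1) (α y)) x :=
    ((ContinuousAlternatingMap.ofSubsingletonLIE (𝕜 := ℝ) (E := E) (F := F)
      (0 : Fin 1)).differentiable _).comp x hα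
  rw [extDeriv_apply hd]
  have h : ∀ w : E, fderiv ℝ (fun y ↦ α y w) x = (fderiv ℝ α x).flip w := by
    intro w
    rw [fderiv_clm_apply hα (differentiableAt_const w)]
    simp
  simp [Fin.sum_univ_two, h, extDerivBilin_apply, Fin.removeNth, sub_eq_add_neg]

theorem two_le_infty : (2 : ℕ∞ω) ≤ ∞ :=
  WithTop.coe_le_coe.2 (le_top : (2 : ℕ∞) ≤ ⊤)

/-- The kernel of the exterior derivative of a one-form is involutive. -/
theorem extDerivBilin_lieBracket {α : E → E →L[ℝ] F} {x : E} (hα : ContDiffAt ℝ ∞ α x)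
    {X Y : E → E} (hX : DifferentiableAt ℝ X x) (hY : DifferentiableAt ℝ Y x)
    (hX0 : ∀ᶠ y in 𝓝 x, extDerivBilin α y (X y) = 0)
    (hY0 : ∀ᶠ y in 𝓝 x, extDerivBilin α y (Y y) = 0) :
    extDerivBilin α x (VectorField.lieBracket ℝ X Y x) = 0 := by
  set D := fderiv ℝ α with hD
  have hDd : HasFDerivAt D (fderiv ℝ D x) x :=
    ((hα.fderiv_right (m := 1) (n := ∞) (by simpa [one_add_one_eq_two] using two_le_infty)).differentiableAt
      (by simp)).hasFDerivAt
  set D2 := fderiv ℝ D x with hD2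
  have hsymm : ∀ a b, D2 a b = D2 b a := (hα.isSymmSndFDerivAt (by simpa using two_le_infty)).eq
  have key : ∀ {Z : E → E}, DifferentiableAt ℝ Z x →
      (∀ᶠ y in 𝓝 x, extDerivBilin α y (Z y) = 0) →
      ∀ a z, extDerivBilin α x (fderiv ℝ Z x a) z = D2 a z (Z x) - D2 a (Z x) z := by
    intro Z hZ hZ0 a z
    have hz := hasFDerivAt_const (𝕜 := ℝ) z x
    have h0 : HasFDerivAt (fun y ↦ extDerivBilin α y (Z y) z) _ x :=
      ((hDd.clm_apply hZ.hasFDerivAt).clm_apply hz).sub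
        ((hDd.clm_apply hz).clm_apply hZ.hasFDerivAt)
    have h1 := h0.unique ((hasFDerivAt_const (0 : F) x).congr_of_eventuallyEq
      (hZ0.mono fun y hy ↦ by simp [hy]))
    have h2 : extDerivBilin α x (fderiv ℝ Z x a) z + (D2 a (Z x) z - D2 a z (Z x)) = 0 := by
      have h3 := congrArg (fun T : E →L[ℝ] F ↦ T a) h1
      simp at h3
      rw [extDerivBilin_apply, ← h3]
      abel
    rw [eq_neg_of_add_eq_zero_left h2]
    abel
  have hXx := hX0.self_of_nhds
  have hYx := hY0.self_of_nhds
  ext z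
  have h3 := key hX hX0 z (Y x)
  rw [extDerivBilin_swap, hYx] at h3
  simp only [zero_apply, neg_zero] at h3
  simp only [VectorField.lieBracket, map_sub, sub_apply, zero_apply]
  rw [key hY hY0, key hX hX0, hsymm (X x) z, hsymm (Y x) z, hsymm (X x) (Y x)]
  rw [eq_comm, sub_eq_zero] at h3
  rw [h3]
  abel

/-- Reeb vector fields commute. -/
theorem reeb_frame_commute {α : E → E →L[ℝ] F} {A : E → F →L[ℝ] E} {s : Set E} (hs : IsOpen s)
    (hα : ContDiffOn ℝ ∞ α s) (hA : ContDiffOn ℝ ∞ A s)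
    (hinf : ∀ x ∈ s, (α x).ker ⊓ (extDerivBilin α x).ker = ⊥)
    (hAα : ∀ y ∈ s, ∀ e, extDerivBilin α y (A y e) = 0 ∧ α y (A y e) = e)
    {y : E} (hy : y ∈ s) (e c : F) : fderiv ℝ A y (A y e) c = fderiv ℝ A y (A y c) e := by
  have hsy := hs.mem_nhds hy
  have hAd := ((hA.contDiffAt hsy).differentiableAt (by simp)).hasFDerivAt
  have hαd := ((hα.contDiffAt hsy).differentiableAt (by simp)).hasFDerivAt
  have hAe : ∀ e, HasFDerivAt (fun z ↦ A z e) ((fderiv ℝ A y).flip e) y := fun e ↦ by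
    simpa using hAd.clm_apply (hasFDerivAt_const e y)
  have hbr : VectorField.lieBracket ℝ (fun z ↦ A z e) (fun z ↦ A z c) y =
      fderiv ℝ A y (A y e) c - fderiv ℝ A y (A y c) e := by
    simp [VectorField.lieBracket, (hAe _).fderiv]
  have h1 := extDerivBilin_lieBracket (hα.contDiffAt hsy) (hAe e).differentiableAt
    (hAe c).differentiableAt
    (Filter.eventually_of_mem hsy fun z hz ↦ (hAα z hz e).1)
    (Filter.eventually_of_mem hsy fun z hz ↦ (hAα z hz c).1)
  have h2 : ∀ e a, α y (fderiv ℝ A y a e) = -fderiv ℝ α y a (A y e) := by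
    intro e a
    have h3 := (hαd.clm_apply (hAe e)).unique
      ((hasFDerivAt_const e y).congr_of_eventuallyEq
        (Filter.eventually_of_mem hsy fun z hz ↦ (hAα z hz e).2))
    have h4 := congrArg (fun T : E →L[ℝ] F ↦ T a) h3
    exact eq_neg_of_add_eq_zero_left (by simpa using h4)
  have h5 : α y (VectorField.lieBracket ℝ (fun z ↦ A z e) (fun z ↦ A z c) y) = 0 := by
    have h6 : extDerivBilin α y (A y e) (A y c) = 0 := by rw [(hAα y hy e).1]; rfl
    rw [extDerivBilin_apply, sub_eq_zero] at h6
    rw [hbr, map_sub, h2, h2, h6]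
    simp
  have h7 : VectorField.lieBracket ℝ (fun z ↦ A z e) (fun z ↦ A z c) y ∈
      (α y).ker ⊓ (extDerivBilin α y).ker := ⟨h5, h1⟩
  rw [hinf y hy, Submodule.mem_bot, hbr, sub_eq_zero] at h7
  exact h7

/-- A function smooth near a point agrees near the point with a globally smooth function. -/
theorem exists_contDiff_eqOn [FiniteDimensional ℝ E] {f : E → F} {s : Set E}
    (hs : IsOpen s) (hf : ContDiffOn ℝ ∞ f s)
    {x : E} (hx : x ∈ s) :
    ∃ (g : E → F) (t : Set E), IsOpen t ∧ x ∈ t ∧ t ⊆ s ∧ ContDiff ℝ ∞ g ∧ Set.EqOn g f t := by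
  obtain ⟨ε, hε, hball⟩ := Metric.isOpen_iff.1 hs x hx
  let χ : ContDiffBump x := ⟨ε / 4, ε / 2, by positivity, by linarith⟩
  refine ⟨fun y ↦ χ y • f y, Metric.ball x (ε / 4), Metric.isOpen_ball,
    Metric.mem_ball_self (by positivity), (Metric.ball_subset_ball (by linarith)).trans hball,
    ?_, ?_⟩
  · rw [contDiff_iff_contDiffAt]
    intro y
    by_cases hy : y ∈ s
    · exact χ.contDiff.contDiffAt.smul (hf.contDiffAt (hs.mem_nhds hy))
    · have h1 : y ∉ tsupport χ := by
        rw [χ.tsupport_eq]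
        exact fun h ↦ hy (hball (Metric.closedBall_subset_ball (half_lt_self hε) h))
      have h2 : (fun y ↦ χ y • f y) =ᶠ[𝓝 y] fun _ ↦ 0 := by
        filter_upwards [(isClosed_tsupport χ).isOpen_compl.mem_nhds h1] with z hz
        rw [image_eq_zero_of_notMem_tsupport hz, zero_smul]
      exact contDiffAt_const.congr_of_eventuallyEq h2
  · intro y hy
    simp only
    rw [χ.one_of_mem_closedBall (Metric.ball_subset_closedBall hy), one_smul]

/-- A local frame of Reeb vector fields, dual to the one-form. -/
theorem exists_reeb_frame [FiniteDimensional ℝ E] [FiniteDimensional ℝ F]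
    {α : E → E →L[ℝ] F} {U : Set E} (hU : IsOpen U) (hα : ContDiffOn ℝ ∞ α U)
    (hrank : ∀ x ∈ U, Module.finrank ℝ (extDerivBilin α x).ker = Module.finrank ℝ F)
    (hinf : ∀ x ∈ U, (α x).ker ⊓ (extDerivBilin α x).ker = ⊥) {x₀ : E} (hx₀ : x₀ ∈ U) :
    ∃ (A : E → F →L[ℝ] E) (s : Set E), IsOpen s ∧ x₀ ∈ s ∧ s ⊆ U ∧ ContDiffOn ℝ ∞ A s ∧
      ∀ y ∈ s, ∀ e, extDerivBilin α y (A y e) = 0 ∧ α y (A y e) = e := by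
  set T : E → E →L[ℝ] (E →L[ℝ] F) × F := fun y ↦
    (ContinuousLinearMap.inl ℝ (E →L[ℝ] F) F).comp (extDerivBilin α y) +
      (ContinuousLinearMap.inr ℝ (E →L[ℝ] F) F).comp (α y) with hTdef
  have hTapply : ∀ y v, T y v = (extDerivBilin α y v, α y v) := fun y v ↦ by simp [hTdef]
  have hTinj : ∀ y ∈ U, Function.Injective (T y) := by
    intro y hy
    rw [injective_iff_map_eq_zero]
    intro v hv
    rw [hTapply] at hv
    have h1 : v ∈ (α y).ker ⊓ (extDerivBilin α y).ker :=
      ⟨congrArg Prod.snd hv, congrArg Prod.fst hv⟩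
    rw [hinf y hy] at h1
    exact h1
  have hTsurj : ∀ y ∈ U, ∀ e, ∃ v, T y v = (0, e) := by
    intro y hy e
    set r : (extDerivBilin α y).ker →ₗ[ℝ] F :=
      (α y : E →ₗ[ℝ] F).domRestrict (extDerivBilin α y).ker
    have hr : Function.Injective r := by
      rw [injective_iff_map_eq_zero]
      rintro ⟨v, hv⟩ hv0
      have h1 : v ∈ (α y).ker ⊓ (extDerivBilin α y).ker := ⟨hv0, hv⟩
      rw [hinf y hy] at h1
      exact Subtype.ext h1
    obtain ⟨v, hv⟩ := (LinearMap.injective_iff_surjective_of_finrank_eq_finrank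
      (hrank y hy)).1 hr e
    exact ⟨v, (hTapply y v).trans (Prod.ext v.2 hv)⟩
  have hB : ContDiffOn ℝ ∞ (extDerivBilin α) U := by
    have hD : ContDiffOn ℝ ∞ (fderiv ℝ α) U := hα.fderiv_of_isOpen hU (by simp)
    refine contDiffOn_clm_apply.2 fun v ↦ contDiffOn_clm_apply.2 fun w ↦ ?_
    exact ((hD.clm_apply contDiffOn_const).clm_apply contDiffOn_const).sub
      ((hD.clm_apply contDiffOn_const).clm_apply contDiffOn_const)
  have hT : ContDiffOn ℝ ∞ T U :=
    (contDiffOn_const.clm_comp hB).add (contDiffOn_const.clm_comp hα)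
  obtain ⟨S₀, hS₀⟩ := (T x₀ : E →ₗ[ℝ] (E →L[ℝ] F) × F).exists_leftInverse_of_injective
    (LinearMap.ker_eq_bot.2 (hTinj x₀ hx₀))
  set S : (E →L[ℝ] F) × F →L[ℝ] E := LinearMap.toContinuousLinearMap S₀
  set Q : E → E →L[ℝ] E := fun y ↦ S.comp (T y)
  have hQ : ContDiffOn ℝ ∞ Q U := contDiffOn_const.clm_comp hT
  have hQ0 : Q x₀ = ContinuousLinearMap.id ℝ E := by
    ext v
    exact LinearMap.congr_fun hS₀ v
  set s : Set E := U ∩ Q ⁻¹' Set.range ((↑) : (E ≃L[ℝ] E) → E →L[ℝ] E)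
  refine ⟨fun y ↦ (Q y).inverse.comp (S.comp (ContinuousLinearMap.inr ℝ (E →L[ℝ] F) F)), s,
    hQ.continuousOn.isOpen_inter_preimage hU ContinuousLinearEquiv.isOpen,
    ⟨hx₀, ContinuousLinearEquiv.refl ℝ E, hQ0.symm⟩, Set.inter_subset_left, ?_, ?_⟩
  · intro y hy
    obtain ⟨L, hL⟩ := hy.2
    have h1 : ContDiffAt ℝ ∞ ContinuousLinearMap.inverse (Q y) := hL ▸ contDiffAt_map_inverse L
    exact ((h1.comp y (hQ.contDiffAt (hU.mem_nhds hy.1))).clm_comp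
      contDiffAt_const).contDiffWithinAt
  · intro y hy e
    obtain ⟨L, hL⟩ := hy.2
    obtain ⟨v, hv⟩ := hTsurj y hy.1 e
    have h1 : (Q y).inverse (S (0, e)) = v := by
      rw [← hv, ← hL, ContinuousLinearMap.inverse_equiv]
      have : S (T y v) = L v := congrArg (fun P : E →L[ℝ] E ↦ P v) hL.symm
      simp [this]
    have h2 : ((Q y).inverse.comp (S.comp (ContinuousLinearMap.inr ℝ (E →L[ℝ] F) F))) e = v := by
      simpa using h1
    rw [hTapply] at hv
    simp only [h2]
    exact ⟨congrArg Prod.fst hv, congrArg Prod.snd hv⟩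

end Local

/-- Around each point there are local coordinates in which the Reeb distribution of a contact form
with values in a vector space is constant. -/
theorem exists_straightening_reeb {E : Type*} [NormedAddCommGroup E] [NormedSpace ℝ E]
    [FiniteDimensional ℝ E] {F : Type} [NormedAddCommGroup F] [NormedSpace ℝ F]
    [FiniteDimensional ℝ F] {α : E → E →L[ℝ] F} {U : Set E} (hU : IsOpen U)
    (hα : ContDiffOn ℝ ∞ α U)
    (hrank : ∀ x ∈ U, Module.finrank ℝ (extDerivBilin α x).ker = Module.finrank ℝ F)
    (hinf : ∀ x ∈ U, (α x).ker ⊓ (extDerivBilin α x).ker = ⊥) {x₀ : E} (hx₀ : x₀ ∈ U) :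
    ∃ ψ : OpenPartialHomeomorph E E, x₀ ∈ ψ.source ∧ ψ.source ⊆ U ∧
      ContDiffOn ℝ ∞ ψ ψ.source ∧ ContDiffOn ℝ ∞ ψ.symm ψ.target ∧
      ∃ V : Submodule ℝ E, ∀ y ∈ ψ.source, ∀ v,
        extDerivBilin α y v = 0 ↔ fderiv ℝ ψ y v ∈ V := by
  have : CompleteSpace E := FiniteDimensional.complete ℝ E
  obtain ⟨A, s, hs, hxs, hsU, hA, hAα⟩ := exists_reeb_frame hU hα hrank hinf hx₀
  obtain ⟨A₁, t, ht, hxt, hts, hA₁, heq⟩ := exists_contDiff_eqOn hs hA hxs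
  have hcomm : ∀ y ∈ t, ∀ e c, fderiv ℝ A₁ y (A₁ y e) c = fderiv ℝ A₁ y (A₁ y c) e := by
    intro y hy e c
    have h1 : A₁ =ᶠ[𝓝 y] A := Filter.eventually_of_mem (ht.mem_nhds hy) heq
    rw [h1.fderiv_eq, heq hy]
    exact reeb_frame_commute hs (hα.mono hsU) hA (fun x hx ↦ hinf x (hsU hx)) hAα (hts hy) e c
  have hinj : Function.Injective (A₁ x₀) := by
    rw [heq hxt]
    exact Function.LeftInverse.injective (g := α x₀) fun e ↦ (hAα x₀ hxs e).2
  obtain ⟨ψ, hx, hsub, h1, h2, V, hV⟩ := exists_straightening_of_commute A₁ hA₁ ht hcomm hxt hinj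
  refine ⟨ψ, hx, hsub.trans (hts.trans hsU), h1, h2, V, fun y hy v ↦ ?_⟩
  rw [← hV y hy v, heq (hsub hy)]
  have hys := hts (hsub hy)
  constructor
  · intro hv
    refine ⟨α y v, ?_⟩
    have h3 : A y (α y v) - v ∈ (α y).ker ⊓ (extDerivBilin α y).ker :=
      ⟨by simp [(hAα y hys _).2], by simp [(hAα y hys _).1, hv]⟩
    rw [hinf y (hsU hys), Submodule.mem_bot, sub_eq_zero] at h3
    exact h3
  · rintro ⟨e, rfl⟩
    exact (hAα y hys e).1

section Manifold

variable {E : Type*} [NormedAddCommGroup E] [NormedSpace ℝ E]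
  {M : Type*} [TopologicalSpace M] [ChartedSpace E M]
  {F : Type*} [NormedAddCommGroup F] [NormedSpace ℝ F]

/-- The derivative at `p` of the preferred chart at `x₀`. -/
def chartDeriv (x₀ p : M) : TangentSpace 𝓘(ℝ, E) p →L[ℝ] E :=
  mfderiv 𝓘(ℝ, E) 𝓘(ℝ, E) (extChartAt 𝓘(ℝ, E) x₀) p

/-- The derivative at `y` of the inverse of the preferred chart at `x₀`. -/
def chartSymmDeriv (x₀ : M) (y : E) :
    E →L[ℝ] TangentSpace 𝓘(ℝ, E) ((extChartAt 𝓘(ℝ, E) x₀).symm y) :=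
  mfderiv 𝓘(ℝ, E) 𝓘(ℝ, E) (extChartAt 𝓘(ℝ, E) x₀).symm y

/-- The coordinate expression of a one-form, as a field of linear maps. -/
def localForm (η : (x : M) → TangentSpace 𝓘(ℝ, E) x →L[ℝ] F) (x₀ : M) (y : E) : E →L[ℝ] F :=
  (η ((extChartAt 𝓘(ℝ, E) x₀).symm y)).comp (chartSymmDeriv x₀ y)

theorem oneFormInChart_eq (η : (x : M) → TangentSpace 𝓘(ℝ, E) x →L[ℝ] F) (x₀ : M) :
    oneFormInChart η x₀ = fun y ↦
      ContinuousAlternatingMap.ofSubsingleton ℝ E F (0 : Fin 1) (localForm η x₀ y) := rfl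

variable [IsManifold 𝓘(ℝ, E) ∞ M]

theorem chartSymmDeriv_chartDeriv {x₀ : M} {y : E} (hy : y ∈ (extChartAt 𝓘(ℝ, E) x₀).target)
    (v : TangentSpace 𝓘(ℝ, E) ((extChartAt 𝓘(ℝ, E) x₀).symm y)) :
    chartSymmDeriv x₀ y (chartDeriv x₀ ((extChartAt 𝓘(ℝ, E) x₀).symm y) v) = v := by
  have : IsManifold 𝓘(ℝ, E) 1 M := IsManifold.of_le (n := ∞) (by simp)
  have h := mfderivWithin_extChartAt_symm_comp_mfderiv_extChartAt (I := 𝓘(ℝ, E)) hy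
  rw [modelWithCornersSelf_coe, Set.range_id, mfderivWithin_univ] at h
  exact congrArg (fun T : TangentSpace 𝓘(ℝ, E) ((extChartAt 𝓘(ℝ, E) x₀).symm y) →L[ℝ]
    TangentSpace 𝓘(ℝ, E) ((extChartAt 𝓘(ℝ, E) x₀).symm y) ↦ T v) h

theorem chartDeriv_chartSymmDeriv {x₀ : M} {y : E} (hy : y ∈ (extChartAt 𝓘(ℝ, E) x₀).target)
    (v : E) :
    chartDeriv x₀ ((extChartAt 𝓘(ℝ, E) x₀).symm y) (chartSymmDeriv x₀ y v) = v := by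
  have : IsManifold 𝓘(ℝ, E) 1 M := IsManifold.of_le (n := ∞) (by simp)
  have h := mfderiv_extChartAt_comp_mfderivWithin_extChartAt_symm (I := 𝓘(ℝ, E)) hy
  rw [modelWithCornersSelf_coe, Set.range_id, mfderivWithin_univ] at h
  exact congrArg (fun T : E →L[ℝ] E ↦ T v) h

/-- The derivative of a chart as a linear equivalence. -/
def chartDerivEquiv {x₀ : M} {y : E} (hy : y ∈ (extChartAt 𝓘(ℝ, E) x₀).target) :
    TangentSpace 𝓘(ℝ, E) ((extChartAt 𝓘(ℝ, E) x₀).symm y) ≃L[ℝ] E :=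
  ContinuousLinearEquiv.equivOfInverse (chartDeriv x₀ _) (chartSymmDeriv x₀ y)
    (chartSymmDeriv_chartDeriv hy) (chartDeriv_chartSymmDeriv hy)

theorem surjective_chartDeriv {x₀ p : M} (hp : p ∈ (extChartAt 𝓘(ℝ, E) x₀).source) :
    Function.Surjective (chartDeriv (E := E) x₀ p) := by
  obtain ⟨y, hy, rfl⟩ : ∃ y ∈ (extChartAt 𝓘(ℝ, E) x₀).target,
      (extChartAt 𝓘(ℝ, E) x₀).symm y = p :=
    ⟨_, (extChartAt 𝓘(ℝ, E) x₀).map_source hp, (extChartAt 𝓘(ℝ, E) x₀).left_inv hp⟩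
  exact (chartDerivEquiv hy).surjective

theorem localForm_chartDeriv (η : (x : M) → TangentSpace 𝓘(ℝ, E) x →L[ℝ] F) {x₀ p : M}
    (hp : p ∈ (extChartAt 𝓘(ℝ, E) x₀).source) (v : TangentSpace 𝓘(ℝ, E) p) :
    localForm η x₀ (extChartAt 𝓘(ℝ, E) x₀ p) (chartDeriv x₀ p v) = η p v := by
  obtain ⟨y, hy, rfl⟩ : ∃ y ∈ (extChartAt 𝓘(ℝ, E) x₀).target,
      (extChartAt 𝓘(ℝ, E) x₀).symm y = p :=
    ⟨_, (extChartAt 𝓘(ℝ, E) x₀).map_source hp, (extChartAt 𝓘(ℝ, E) x₀).left_inv hp⟩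
  rw [(extChartAt 𝓘(ℝ, E) x₀).right_inv hy]
  exact congrArg (η _) (chartSymmDeriv_chartDeriv hy v)

theorem contDiffOn_localForm {η : (x : M) → TangentSpace 𝓘(ℝ, E) x →L[ℝ] F}
    (hη : IsSmoothOneForm η) (x₀ : M) :
    ContDiffOn ℝ ∞ (localForm η x₀) (extChartAt 𝓘(ℝ, E) x₀).target := by
  have : IsManifold 𝓘(ℝ, E) 1 M := IsManifold.of_le (n := ∞) (by simp)
  set e := trivializationAt (E →L[ℝ] F)
    (fun x : M ↦ TangentSpace 𝓘(ℝ, E) x →L[ℝ] Bundle.Trivial M F x) x₀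
  have hbase : (extChartAt 𝓘(ℝ, E) x₀).source ⊆ e.baseSet := by
    intro x hx
    rw [hom_trivializationAt_baseSet]
    exact ⟨by simpa using hx, trivial⟩
  have h1 : ContMDiffOn 𝓘(ℝ, E) 𝓘(ℝ, E →L[ℝ] F) ∞ (fun x ↦ (e ⟨x, η x⟩).2)
      (extChartAt 𝓘(ℝ, E) x₀).source :=
    (e.contMDiffOn_section_iff (isOpen_extChartAt_source x₀) hbase).1 hη.contMDiffOn
  rw [← contMDiffOn_iff_contDiffOn]
  refine (h1.comp (contMDiffOn_extChartAt_symm x₀)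
    (extChartAt 𝓘(ℝ, E) x₀).mapsTo_symm).congr fun y hy ↦ ?_
  have hx : (extChartAt 𝓘(ℝ, E) x₀).symm y ∈ (chartAt E x₀).source := by
    have := (extChartAt 𝓘(ℝ, E) x₀).map_target hy
    rwa [extChartAt_source] at this
  have h2 := TangentBundle.symmL_trivializationAt (I := 𝓘(ℝ, E)) hx
  rw [modelWithCornersSelf_coe, Set.range_id, mfderivWithin_univ,
    (extChartAt 𝓘(ℝ, E) x₀).right_inv hy] at h2
  ext w
  have h3 : (e ⟨_, η ((extChartAt 𝓘(ℝ, E) x₀).symm y)⟩).2 =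
      ((trivializationAt F (Bundle.Trivial M F) x₀).continuousLinearMapAt ℝ _).comp
        ((η ((extChartAt 𝓘(ℝ, E) x₀).symm y)).comp
          ((trivializationAt E (TangentSpace 𝓘(ℝ, E)) x₀).symmL ℝ _)) := rfl
  rw [Function.comp_apply, h3, h2]
  simp
  rfl

end Manifold

section Reeb

variable {E : Type*} [NormedAddCommGroup E] [NormedSpace ℝ E]
  {M : Type*} [TopologicalSpace M] [ChartedSpace E M] [IsManifold 𝓘(ℝ, E) ∞ M]
  {F : Type*} [NormedAddCommGroup F] [NormedSpace ℝ F]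

/-- The exterior derivative of a one-form can be computed in any preferred chart. -/
theorem extDerivOneForm_apply {η : (x : M) → TangentSpace 𝓘(ℝ, E) x →L[ℝ] F}
    (hη : IsSmoothOneForm η) {x₀ x : M} (hx : x ∈ (extChartAt 𝓘(ℝ, E) x₀).source)
    (v : Fin 2 → TangentSpace 𝓘(ℝ, E) x) :
    extDerivOneForm η x v = extDerivBilin (localForm η x₀) (extChartAt 𝓘(ℝ, E) x₀ x)
      (chartDeriv x₀ x (v 0)) (chartDeriv x₀ x (v 1)) := by
  have : IsManifold 𝓘(ℝ, E) 1 M := IsManifold.of_le (n := ∞) (by simp)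
  set φ := extChartAt 𝓘(ℝ, E) x
  set φ₀ := extChartAt 𝓘(ℝ, E) x₀
  set f : E → E := φ₀ ∘ φ.symm
  have hxx : φ.symm (φ x) = x := extChartAt_to_inv x
  have hfx : f (φ x) = φ₀ x := congrArg φ₀ hxx
  have hsm : IsOpen (φ.target ∩ φ.symm ⁻¹' φ₀.source) :=
    (continuousOn_extChartAt_symm x).isOpen_inter_preimage (isOpen_extChartAt_target x)
      (isOpen_extChartAt_source x₀)
  have hmem : φ x ∈ φ.target ∩ φ.symm ⁻¹' φ₀.source :=
    ⟨mem_extChartAt_target x, by rw [Set.mem_preimage, hxx]; exact hx⟩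
  have hfd : ContDiffOn ℝ ∞ f (φ.target ∩ φ.symm ⁻¹' φ₀.source) := by
    rw [← contMDiffOn_iff_contDiffOn]
    refine (contMDiffOn_extChartAt (x := x₀) (I := 𝓘(ℝ, E)) (n := ∞)).comp
      ((contMDiffOn_extChartAt_symm x).mono Set.inter_subset_left) fun y hy ↦ ?_
    have := hy.2
    rwa [Set.mem_preimage, extChartAt_source] at this
  have hfder : ∀ y ∈ φ.target ∩ φ.symm ⁻¹' φ₀.source, ∀ w,
      fderiv ℝ f y w = chartDeriv x₀ (φ.symm y) (chartSymmDeriv x y w) := by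
    intro y hy w
    have h1 : MDifferentiableAt 𝓘(ℝ, E) 𝓘(ℝ, E) φ₀ (φ.symm y) :=
      mdifferentiableAt_extChartAt (by rw [← extChartAt_source 𝓘(ℝ, E)]; exact hy.2)
    have h2 : MDifferentiableAt 𝓘(ℝ, E) 𝓘(ℝ, E) φ.symm y := by
      have := mdifferentiableWithinAt_extChartAt_symm (I := 𝓘(ℝ, E)) hy.1
      rwa [modelWithCornersSelf_coe, Set.range_id, mdifferentiableWithinAt_univ] at this
    have h3 := mfderiv_comp y h1 h2
    rw [← mfderiv_eq_fderiv]
    exact congrArg (fun T : E →L[ℝ] E ↦ T w) h3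
  have hpull : oneFormInChart η x =ᶠ[𝓝 (φ x)] fun y ↦
      (oneFormInChart η x₀ (f y)).compContinuousLinearMap (fderiv ℝ f y) := by
    filter_upwards [hsm.mem_nhds hmem] with y hy
    ext w
    change localForm η x y (w 0) = localForm η x₀ (f y) (fderiv ℝ f y (w 0))
    rw [hfder y hy]
    exact (localForm_chartDeriv η hy.2 _).symm
  have hform : DifferentiableAt ℝ (localForm η x₀) (φ₀ x) :=
    ((contDiffOn_localForm hη x₀).contDiffAt
      ((isOpen_extChartAt_target x₀).mem_nhds (φ₀.map_source hx))).differentiableAt (by simp)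
  have hform' : DifferentiableAt ℝ (oneFormInChart η x₀) (f (φ x)) := by
    rw [hfx]
    exact ((ContinuousAlternatingMap.ofSubsingletonLIE (𝕜 := ℝ) (E := E) (F := F)
      (0 : Fin 1)).differentiable _).comp _ hform
  have hd : extDeriv (oneFormInChart η x) (φ x) =
      (extDeriv (oneFormInChart η x₀) (f (φ x))).compContinuousLinearMap
        (fderiv ℝ f (φ x)) := by
    rw [hpull.extDeriv_eq]
    exact extDeriv_pullback hform' (hfd.contDiffAt (hsm.mem_nhds hmem))
      (by simpa using two_le_infty)
  have hcomp : ∀ u : TangentSpace 𝓘(ℝ, E) x,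
      fderiv ℝ f (φ x) (chartDeriv x x u) = chartDeriv x₀ x u := by
    intro u
    have h1 : MDifferentiableAt 𝓘(ℝ, E) 𝓘(ℝ, E) φ x :=
      mdifferentiableAt_extChartAt (mem_chart_source E x)
    have h2 : MDifferentiableAt 𝓘(ℝ, E) 𝓘(ℝ, E) f (φ x) :=
      ((hfd.contDiffAt (hsm.mem_nhds hmem)).differentiableAt (by simp)).mdifferentiableAt
    have h3 := mfderiv_comp x h2 h1
    have h4 : f ∘ φ =ᶠ[𝓝 x] φ₀ := by
      filter_upwards [extChartAt_source_mem_nhds (I := 𝓘(ℝ, E)) x] with z hz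
      exact congrArg φ₀ (φ.left_inv hz)
    have h5 : mfderiv 𝓘(ℝ, E) 𝓘(ℝ, E) (f ∘ φ) x u = mfderiv 𝓘(ℝ, E) 𝓘(ℝ, E) φ₀ x u := by
      rw [h4.mfderiv_eq]
      rfl
    rw [← mfderiv_eq_fderiv]
    refine Eq.trans ?_ h5
    rw [h3]
    rfl
  change extDeriv (oneFormInChart η x) (φ x) (fun i ↦ chartDeriv x x (v i)) = _
  rw [hd]
  change extDeriv (oneFormInChart η x₀) (f (φ x))
    (fun i ↦ fderiv ℝ f (φ x) (chartDeriv x x (v i))) = _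
  simp only [hcomp, hfx]
  rw [oneFormInChart_eq, extDeriv_ofSubsingleton_apply hform]

theorem mem_reebDistribution_iff {η : (x : M) → TangentSpace 𝓘(ℝ, E) x →L[ℝ] F}
    (hη : IsSmoothOneForm η) {x₀ x : M} (hx : x ∈ (extChartAt 𝓘(ℝ, E) x₀).source)
    (v : TangentSpace 𝓘(ℝ, E) x) :
    v ∈ reebDistribution η x ↔
      extDerivBilin (localForm η x₀) (extChartAt 𝓘(ℝ, E) x₀ x) (chartDeriv x₀ x v) = 0 := by
  have h : ∀ w : Fin 1 → TangentSpace 𝓘(ℝ, E) x,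
      (extDerivOneForm η x).toAlternatingMap.curryLeft v w =
        extDerivBilin (localForm η x₀) (extChartAt 𝓘(ℝ, E) x₀ x) (chartDeriv x₀ x v)
          (chartDeriv x₀ x (w 0)) := fun w ↦
    extDerivOneForm_apply hη hx (Matrix.vecCons v w)
  rw [reebDistribution, LinearMap.mem_ker]
  constructor
  · intro h0
    ext z
    obtain ⟨u, rfl⟩ := surjective_chartDeriv hx z
    rw [← h (fun _ ↦ u), h0]
    rfl
  · intro h0
    ext w
    rw [h w, h0]
    rfl

theorem mem_kerForm_iff (η : (x : M) → TangentSpace 𝓘(ℝ, E) x →L[ℝ] F) {x₀ x : M}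
    (hx : x ∈ (extChartAt 𝓘(ℝ, E) x₀).source) (v : TangentSpace 𝓘(ℝ, E) x) :
    v ∈ kerForm η x ↔ localForm η x₀ (extChartAt 𝓘(ℝ, E) x₀ x) (chartDeriv x₀ x v) = 0 := by
  rw [localForm_chartDeriv η hx]
  rfl

/-- The Reeb distribution of a smooth one-form is involutive. -/
theorem isInvolutive_reebDistribution [CompleteSpace E]
    {η : (x : M) → TangentSpace 𝓘(ℝ, E) x →L[ℝ] F} (hη : IsSmoothOneForm η) :
    IsInvolutive (reebDistribution η) := by
  have : IsManifold 𝓘(ℝ, E) 1 M := IsManifold.of_le (n := ∞) (by simp)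
  intro U X Y hU hX hY hXD hYD x hx
  set φ := extChartAt 𝓘(ℝ, E) x with hφ
  have hxs : x ∈ φ.source := mem_extChartAt_source x
  have hpb : ∀ Z : (x : M) → TangentSpace 𝓘(ℝ, E) x,
      ContMDiffOn 𝓘(ℝ, E) 𝓘(ℝ, E).tangent ∞ (fun x ↦ (⟨x, Z x⟩ : TangentBundle 𝓘(ℝ, E) M)) U →
      (∀ x ∈ U, Z x ∈ reebDistribution η x) →
      DifferentiableAt ℝ (fun y : E ↦ ((chartSymmDeriv x y).inverse (Z (φ.symm y)) : E)) (φ x) ∧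
      ∀ᶠ y in 𝓝 (φ x), extDerivBilin (localForm η x) y
        ((chartSymmDeriv x y).inverse (Z (φ.symm y))) = 0 := by
    intro Z hZ hZD
    constructor
    · have h1 := VectorField.contMDiffWithinAt_mpullbackWithin_extChartAt_symm (m := 1) (n := ∞)
        ((hZ x hx).of_le (by simp)) hU.uniqueMDiffOn hx
        (by simpa [one_add_one_eq_two] using two_le_infty)
      have h2 : φ.target ∩ φ.symm ⁻¹' U ∈ 𝓝 (φ x) :=
        ((continuousOn_extChartAt_symm x).isOpen_inter_preimage (isOpen_extChartAt_target x)
          hU).mem_nhds ⟨mem_extChartAt_target x, by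
            rw [Set.mem_preimage, extChartAt_to_inv]; exact hx⟩
      have h3 := h1.contMDiffAt h2
      rw [contMDiffAt_vectorSpace_iff_contDiffAt] at h3
      have h4 := h3.differentiableAt (by simp)
      rw [modelWithCornersSelf_coe, Set.range_id, VectorField.mpullbackWithin_univ] at h4
      exact h4
    · have h2 : φ.target ∩ φ.symm ⁻¹' U ∈ 𝓝 (φ x) :=
        ((continuousOn_extChartAt_symm x).isOpen_inter_preimage (isOpen_extChartAt_target x)
          hU).mem_nhds ⟨mem_extChartAt_target x, by
            rw [Set.mem_preimage, extChartAt_to_inv]; exact hx⟩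
      filter_upwards [h2] with y hy
      have h3 := (mem_reebDistribution_iff hη (φ.map_target hy.1) _).1 (hZD _ hy.2)
      rw [φ.right_inv hy.1] at h3
      have h4 : (chartSymmDeriv x y).inverse = chartDeriv x (φ.symm y) :=
        ContinuousLinearMap.inverse_equiv (chartDerivEquiv hy.1).symm
      rw [h4]
      exact h3
  obtain ⟨hX1, hX2⟩ := hpb X hX hXD
  obtain ⟨hY1, hY2⟩ := hpb Y hY hYD
  have hcontDiff : ContDiffAt ℝ ∞ (localForm η x) (φ x) :=
    (contDiffOn_localForm hη x).contDiffAt (extChartAt_target_mem_nhds x)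
  have key := extDerivBilin_lieBracket hcontDiff hX1 hY1 hX2 hY2
  rw [mem_reebDistribution_iff hη hxs]
  have hbr : chartDeriv x x (VectorField.mlieBracket 𝓘(ℝ, E) X Y x) =
      VectorField.lieBracket ℝ (fun y : E ↦ ((chartSymmDeriv x y).inverse (X (φ.symm y)) : E))
        (fun y : E ↦ ((chartSymmDeriv x y).inverse (Y (φ.symm y)) : E)) (φ x) := by
    rw [← VectorField.mlieBracketWithin_univ, VectorField.mlieBracketWithin_apply,
      modelWithCornersSelf_coe, Set.range_id, Set.preimage_univ, Set.univ_inter]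
    refine ((isInvertible_mfderiv_extChartAt (I := 𝓘(ℝ, E)) hxs).self_apply_inverse _).trans ?_
    have h : ∀ V W V' W' : E → E, V = V' → W = W' →
        VectorField.lieBracketWithin ℝ V W Set.univ (φ x) =
          VectorField.lieBracket ℝ V' W' (φ x) := by
      rintro V W _ _ rfl rfl
      rw [VectorField.lieBracketWithin_univ]
    exact h _ _ _ _ (VectorField.mpullbackWithin_univ) (VectorField.mpullbackWithin_univ)
  rw [hbr]
  exact key

end Reeb

/-- The Reeb distribution of a contact form with values in a vector space is integrable. -/
theorem isIntegrable_reebDistribution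
    {E : Type*} [NormedAddCommGroup E] [NormedSpace ℝ E] [FiniteDimensional ℝ E]
    {M : Type*} [TopologicalSpace M] [ChartedSpace E M] [IsManifold 𝓘(ℝ, E) ∞ M]
    {F : Type} [NormedAddCommGroup F] [NormedSpace ℝ F] [FiniteDimensional ℝ F]
    {η : (x : M) → TangentSpace 𝓘(ℝ, E) x →L[ℝ] F} (hη : IsSmoothOneForm η)
    (hrank : ∀ x, Module.finrank ℝ (reebDistribution η x) = Module.finrank ℝ F)
    (hinf : ∀ x, kerForm η x ⊓ reebDistribution η x = ⊥) :
    IsIntegrable (reebDistribution η) := by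
  have : IsManifold 𝓘(ℝ, E) 1 M := IsManifold.of_le (n := ∞) (by simp)
  intro x
  set φ := extChartAt 𝓘(ℝ, E) x with hφ
  set α := localForm η x with hα
  have hmem : ∀ {y : E} (hy : y ∈ φ.target) (v : TangentSpace 𝓘(ℝ, E) (φ.symm y)),
      v ∈ reebDistribution η (φ.symm y) ↔ extDerivBilin α y (chartDeriv x _ v) = 0 := by
    intro y hy v
    rw [mem_reebDistribution_iff hη (φ.map_target hy), φ.right_inv hy]
  have hmem' : ∀ {y : E} (hy : y ∈ φ.target) (v : TangentSpace 𝓘(ℝ, E) (φ.symm y)),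
      v ∈ kerForm η (φ.symm y) ↔ α y (chartDeriv x _ v) = 0 := by
    intro y hy v
    rw [mem_kerForm_iff η (φ.map_target hy), φ.right_inv hy]
  have hr : ∀ y ∈ φ.target, Module.finrank ℝ (extDerivBilin α y).ker = Module.finrank ℝ F := by
    intro y hy
    have hmap : (extDerivBilin α y).ker =
        (reebDistribution η (φ.symm y)).map (chartDerivEquiv hy).toLinearEquiv.toLinearMap := by
      ext z
      obtain ⟨v, rfl⟩ := (chartDerivEquiv hy).surjective z
      rw [Submodule.mem_map_equiv]
      change _ ↔ (chartDerivEquiv hy).symm (chartDerivEquiv hy v) ∈ _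
      rw [ContinuousLinearEquiv.symm_apply_apply, hmem hy]
      rfl
    rw [← hrank (φ.symm y), hmap]
    exact LinearEquiv.finrank_map_eq (chartDerivEquiv hy).toLinearEquiv _
  have hi : ∀ y ∈ φ.target, (α y).ker ⊓ (extDerivBilin α y).ker = ⊥ := by
    intro y hy
    rw [eq_bot_iff]
    rintro z ⟨h1, h2⟩
    obtain ⟨v, rfl⟩ := (chartDerivEquiv hy).surjective z
    have h3 : v ∈ kerForm η (φ.symm y) ⊓ reebDistribution η (φ.symm y) :=
      ⟨(hmem' hy v).2 h1, (hmem hy v).2 h2⟩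
    rw [hinf, Submodule.mem_bot] at h3
    rw [h3, map_zero]
    exact Submodule.zero_mem _
  obtain ⟨ψ, hxψ, hψt, hψ, hψs, V, hV⟩ := exists_straightening_reeb (isOpen_extChartAt_target x)
    (contDiffOn_localForm hη x) hr hi (mem_extChartAt_target x)
  have hce : (chartAt E x : M → E) = φ := by simp [hφ]
  have hsrc : ((chartAt E x).trans ψ).source = (chartAt E x).source ∩ φ ⁻¹' ψ.source := by
    rw [OpenPartialHomeomorph.trans_source, hce]
  have hφs : (chartAt E x).source = φ.source := by rw [extChartAt_source]
  refine ⟨(chartAt E x).trans ψ, ?_, ?_, V, ?_⟩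
  · refine OpenPartialHomeomorph.mem_maximalAtlas_of_contMDiffOn _ ?_ ?_
    · refine (contMDiffOn_iff_contDiffOn.2 hψ).comp
        ((contMDiffOn_chart (I := 𝓘(ℝ, E)) (n := ∞)).mono fun z hz ↦ hz.1) fun z hz ↦ hz.2
    · refine (contMDiffOn_chart_symm (I := 𝓘(ℝ, E)) (n := ∞)).comp
        ((contMDiffOn_iff_contDiffOn.2 hψs).mono fun z hz ↦ hz.1) fun z hz ↦ hz.2
  · rw [hsrc]
    exact ⟨mem_chart_source E x, hxψ⟩
  · intro p hp v
    rw [hsrc] at hp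
    have hpφ : p ∈ φ.source := hφs ▸ hp.1
    rw [mem_reebDistribution_iff hη hpφ, hV _ hp.2]
    have h1 : MDifferentiableAt 𝓘(ℝ, E) 𝓘(ℝ, E) φ p := mdifferentiableAt_extChartAt hp.1
    have h2 : MDifferentiableAt 𝓘(ℝ, E) 𝓘(ℝ, E) ψ (φ p) :=
      ((hψ.contDiffAt (ψ.open_source.mem_nhds hp.2)).differentiableAt (by simp)).mdifferentiableAt
    have h3 := mfderiv_comp p h2 h1
    have h4 : (((chartAt E x).trans ψ : OpenPartialHomeomorph M E) : M → E) = ψ ∘ φ := by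
      rw [OpenPartialHomeomorph.coe_trans, hce]
    have h5 : (mfderiv 𝓘(ℝ, E) 𝓘(ℝ, E) ((chartAt E x).trans ψ) p v : E) =
        fderiv ℝ ψ (φ p) (chartDeriv x p v) := by
      rw [h4, h3, mfderiv_eq_fderiv]
      rfl
    rw [h5]
    exact Iff.rfl

end KContact

end

theorem mainTheorem9 {E : Type*} [NormedAddCommGroup E] [NormedSpace ℝ E] [FiniteDimensional ℝ E]
    {M : Type*} [TopologicalSpace M] [ChartedSpace E M] [IsManifold 𝓘(ℝ, E) ∞ M]
    (k : ℕ) (η : (x : M) → TangentSpace 𝓘(ℝ, E) x →L[ℝ] (Fin k → ℝ))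
    (hη : KContact.IsKContactForm η) :
    KContact.IsRegular (KContact.reebDistribution η) ∧
      KContact.IsInvolutive (KContact.reebDistribution η) ∧
      KContact.IsIntegrable (KContact.reebDistribution η) := by
  have : CompleteSpace E := FiniteDimensional.complete ℝ E
  refine ⟨?_, KContact.isInvolutive_reebDistribution hη.smooth,
    KContact.isIntegrable_reebDistribution hη.smooth (fun x ↦ ?_) hη.ker_inf_reeb⟩
  · have hconst : (fun x ↦ Module.finrank ℝ (KContact.reebDistribution η x)) =
        Function.const M k := funext hη.rank_reeb
    rw [KContact.IsRegular, hconst]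
    exact IsLocallyConstant.const k
  · rw [hη.rank_reeb, Module.finrank_fin_fun]
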